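/- A constructive compact space is a compact metric space $(X,d)$ with points $\nu(0),\nu(1),\nu(2),\dots\in X$ (repetitions allowed), presented by a pair of programs $(\mathrm{net},\mathrm{dst})$: for every rational $\varepsilon>0$ (given as a fraction of positive integers), $\mathrm{net}(\varepsilon)$ halts and outputs a finite list of natural numbers $i_1,\dots,i_k$ such that $\{\nu(i_1),\dots,\nu(i_k)\}$ is an $\varepsilon$-net of $X$, i.e. for every $x\in X$ there is some $l$ with $d(x,\nu(i_l))<\varepsilon$; and for all natural numbers $i,j$ and every rational $\varepsilon>0$, $\mathrm{dst}(i,j,\varepsilon)$ halts and outputs a rational number $r\ge 0$ (as a fraction) with $|d(\nu(i),\nu(j))-r|<\varepsilon$. The pair of programs determines $X$ up to isometry. **Theorem 1.** There is no algorithm which decides, for an arbitrary constructive compact space, whether its second homotopy group is trivial. That is, there is no partial computable function $Q$ such that, whenever a pair of programs $P=(\mathrm{net},\mathrm{dst})$ presents a compact metric space $X$, the computation $Q(P)$ halts, with the answer "yes" if $\pi_2(X,x_0)$ is trivial for every base point $x_0\in X$, and with the answer "no" otherwise. -/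

import Mathlib

open Nat.Partrec (Code)

/-- `IsConstructivePresentation X net dst ν` says that the two programs `net` and `dst`, together
with the numbering `ν` of points of `X` by natural numbers (repetitions are allowed, and `ν` need
not be surjective), make the metric space `X` a constructively totally bounded metric space.
Positive rationals are handed to the programs as fractions `p / q` of positive integers. -/
structure IsConstructivePresentation (X : Type) [MetricSpace X] (net dst : Code) (ν : ℕ → X) :
    Prop where
  /-- On the input `ε = p / q`, the program `net` halts and prints a finite list of numbers of
  points which form an `ε`-net of `X`. -/
  net_spec : ∀ p q : ℕ, 0 < p → 0 < q →
    ∃ L : List ℕ, Encodable.encode L ∈ net.eval (Encodable.encode (p, q)) ∧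
      ∀ x : X, ∃ i ∈ L, dist x (ν i) < (p : ℝ) / q
  /-- The metric is computable: on the numbers `i`, `j` of two points and a precision
  `ε = p / q`, the program `dst` halts and prints a fraction `a / b` which differs from the
  distance of the two points by less than `ε`. -/
  dst_spec : ∀ i j p q : ℕ, 0 < p → 0 < q →
    ∃ a b : ℕ, 0 < b ∧ Encodable.encode (a, b) ∈ dst.eval (Encodable.encode ((i, j), (p, q))) ∧
      |dist (ν i) (ν j) - (a : ℝ) / b| < (p : ℝ) / q

/-- The pair of programs `P` presents the compact metric space `X` as a constructive compact
space. Up to isometry, `X` is determined by `P`. -/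
def Presents (P : Code × Code) (X : Type) [MetricSpace X] [CompactSpace X] : Prop :=
  ∃ ν : ℕ → X, IsConstructivePresentation X P.1 P.2 ν

/-- The second homotopy group of `X` is trivial (at every base point). -/
def TrivialPi2 (X : Type) [TopologicalSpace X] : Prop :=
  ∀ x : X, Subsingleton (HomotopyGroup.Pi 2 X x)

open scoped unitInterval Topology

/-! The halting problem reduces to the triviality of `π₂`. To a program `c` corresponds the sphere
`I² / ∂I²`, embedded in `ℝ³` and scaled by `r = haltRadius c`, which is `1 / (t + 1)` if `c` halts
at stage `t` and `0` otherwise. Running `c` up to stage `K` determines `r` up to `1 / (K + 1)`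
(`abs_haltRadius_sub_le`), so a presentation is computable from `c` without knowing whether `c`
halts (`presents_collapsedSquare`). For `r = 0` the space is a point; for `r ≠ 0` its `π₂` is not
trivial.

The latter is shown with the tautological line bundle (`not_subsingleton_pi_two_of_collapse`). Over
the square, `squareLift` spans a field of lines in `ℂ²`, equal to `ℂ × 0` on the boundary, so its
projections descend to the sphere. Along a nullhomotopy rel boundary, orthogonal projection in small
time steps carries the section `squareLift` to a nonvanishing section of the constant line `ℂ × 0`,
with unchanged boundary values. These wind once around the origin, which is impossible for a
nonvanishing function on the square (`not_exists_nonvanishing_extension`). -/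

/-! ### Continuation in time and winding numbers on the square. -/

/-- Steps in both time directions make the set of good times clopen, and `I` is connected. -/
theorem unitInterval.prop_one_of_small_steps {P : I → Prop} {δ : ℝ} (hδ : 0 < δ) (h0 : P 0)
    (step : ∀ s t : I, dist s t < δ → P s → P t) : P 1 := by
  have h : IsClopen {t | P t} := by
    refine ⟨⟨Metric.isOpen_iff.2 fun t ht => ⟨δ, hδ, fun s hs h => ht ?_⟩⟩,
      Metric.isOpen_iff.2 fun t ht => ⟨δ, hδ, fun s hs => ?_⟩⟩
    · exact step s t hs h
    · exact step t s (by rwa [dist_comm]) ht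
  exact Set.eq_univ_iff_forall.1 (h.eq_univ ⟨0, h0⟩) 1

/-- A homotopy from a compact space is uniformly continuous in time. -/
theorem exists_uniform_time_step {A E : Type*} [TopologicalSpace A] [CompactSpace A]
    [PseudoMetricSpace E] {G : I × A → E} (hG : Continuous G) {ε : ℝ} (hε : 0 < ε) :
    ∃ δ > 0, ∀ s t : I, dist s t < δ → ∀ x, dist (G (s, x)) (G (t, x)) < ε := by
  let F : C(I, C(A, E)) := ContinuousMap.curry ⟨G, hG⟩
  obtain ⟨δ, hδ, h⟩ := Metric.uniformContinuous_iff.1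
    (CompactSpace.uniformContinuous_of_continuous F.continuous) ε hε
  exact ⟨δ, hδ, fun s t hst x => (ContinuousMap.dist_lt_iff hε).1 (h hst) x⟩

/-- A nowhere vanishing continuous function on a cube has a continuous logarithm. -/
theorem exists_continuous_log {N : Type*} {c : (I^N) → ℂ} (hc : Continuous c)
    (h0 : ∀ x, c x ≠ 0) : ∃ g : (I^N) → ℂ, Continuous g ∧ ∀ x, Complex.exp (g x) = c x := by
  have hcont : Continuous fun p : I × (I^N) => fun i => p.1 * p.2 i := by fun_prop
  obtain ⟨m, hm, hmc⟩ : ∃ m, 0 < m ∧ ∀ x ∈ Set.univ, m ≤ ‖c x‖ :=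
    isCompact_univ.exists_forall_le' (f := fun x => ‖c x‖) hc.norm.continuousOn
      (a := 0) fun x _ => norm_pos_iff.2 (h0 x)
  obtain ⟨δ, hδ, h⟩ := exists_uniform_time_step (hc.comp hcont) hm
  -- The logarithm is continued along the contraction of the cube to `0`, starting from a constant.
  suffices h : ∃ g : (I^N) → ℂ, Continuous g ∧
      ∀ x, Complex.exp (g x) = c (fun i => (1 : I) * x i) by simpa using h
  refine unitInterval.prop_one_of_small_steps
    (P := fun t => ∃ g : (I^N) → ℂ, Continuous g ∧
      ∀ x, Complex.exp (g x) = c (fun i => t * x i)) hδ ?_ ?_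
  · exact ⟨fun _ => Complex.log (c 0), continuous_const, fun x => by
      rw [Complex.exp_log (h0 _)]; congr 1; ext i; simp⟩
  · rintro s t hst ⟨g, hg, hgc⟩
    -- Values move by less than the minimum `m` of `‖c‖`, so the ratio is within `1` of `1`, where
    -- the principal logarithm is continuous.
    have key : ∀ x : I^N, c (fun i => t * x i) / c (fun i => s * x i) ∈ Complex.slitPlane := by
      intro x
      have h1 := (h s t hst x).trans_le (hmc (fun i => s * x i) trivial)
      have h2 : ‖c (fun i => t * x i) / c (fun i => s * x i) - 1‖ < 1 := by
        rw [div_sub_one (h0 _), norm_div, div_lt_one (norm_pos_iff.2 (h0 _))]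
        simpa [dist_eq_norm, norm_sub_rev] using h1
      simpa using Complex.mem_slitPlane_of_norm_lt_one h2
    refine ⟨fun x => g x + Complex.log (c (fun i => t * x i) / c (fun i => s * x i)), ?_, ?_⟩
    · refine hg.add (Continuous.clog (Continuous.div (by fun_prop) (by fun_prop) fun x => h0 _) key)
    · intro x
      rw [Complex.exp_add, hgc, Complex.exp_log (div_ne_zero (h0 _) (h0 _)), mul_div_cancel₀ _ (h0 _)]

/-- The affine identification of the unit square with `[-1, 1] × [-1, 1]` in the complex plane. -/
def squareToComplex (x : I^(Fin 2)) : ℂ := ⟨2 * x 0 - 1, 2 * x 1 - 1⟩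

theorem continuous_squareToComplex : Continuous squareToComplex := by
  have : squareToComplex = fun x : I^(Fin 2) =>
      ((2 * x 0 - 1 : ℝ) : ℂ) + ((2 * x 1 - 1 : ℝ) : ℂ) * Complex.I := by
    funext x
    rw [← Complex.mk_eq_add_mul_I]; rfl
  rw [this]
  fun_prop

/-- The unit circle is pushed radially onto the boundary by dividing by the sup norm `ρ`. -/
theorem exists_square_boundary_param :
    ∃ γ : ℝ → I^(Fin 2), Continuous γ ∧ γ 0 = γ (2 * Real.pi) ∧
      ∀ θ, γ θ ∈ Cube.boundary (Fin 2) ∧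
        ∃ r : ℝ, 0 < r ∧ squareToComplex (γ θ) = r * Complex.exp (θ * Complex.I) := by
  set ρ : ℝ → ℝ := fun θ => max |Real.cos θ| |Real.sin θ| with hρ
  have hρ0 : ∀ θ, 0 < ρ θ := fun θ => by
    rw [hρ]
    simp only [lt_max_iff, abs_pos]
    by_contra! h
    have := Real.sin_sq_add_cos_sq θ
    simp [h.1, h.2] at this
  have hbd : ∀ θ u : ℝ, |u| ≤ ρ θ → (1 + u / ρ θ) / 2 ∈ I := fun θ u hu => by
    have h1 : |u / ρ θ| ≤ 1 := by
      rw [abs_div, abs_of_pos (hρ0 θ)]; exact (div_le_one (hρ0 θ)).2 hu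
    have := abs_le.1 h1
    constructor <;> linarith
  have hρc : Continuous ρ := by fun_prop
  refine ⟨fun θ => ![⟨(1 + Real.cos θ / ρ θ) / 2, hbd _ _ (le_max_left _ _)⟩,
    ⟨(1 + Real.sin θ / ρ θ) / 2, hbd _ _ (le_max_right _ _)⟩], ?_, ?_, fun θ => ⟨?_, ?_⟩⟩
  · refine continuous_pi fun i => ?_
    have h1 : Continuous fun θ => (1 + Real.cos θ / ρ θ) / 2 := by
      have := fun θ => (hρ0 θ).ne'; fun_prop (disch := assumption)
    have h2 : Continuous fun θ => (1 + Real.sin θ / ρ θ) / 2 := by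
      have := fun θ => (hρ0 θ).ne'; fun_prop (disch := assumption)
    fin_cases i
    · exact h1.subtype_mk _
    · exact h2.subtype_mk _
  · simp [hρ]
  · have h3 : ∀ u : ℝ, |u| = ρ θ → (1 + u / ρ θ) / 2 = 0 ∨ (1 + u / ρ θ) / 2 = 1 := by
      intro u hu
      have := (hρ0 θ).ne'
      rcases abs_choice u with h | h <;> rw [h] at hu
      · right; rw [hu, div_self this]; norm_num
      · left; rw [← hu, div_neg_self (by rintro rfl; simp at hu; exact this hu.symm)]; norm_num
    rcases max_choice |Real.cos θ| |Real.sin θ| with h | h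
    · exact ⟨0, by simpa [Subtype.ext_iff] using h3 _ h.symm⟩
    · exact ⟨1, by simpa [Subtype.ext_iff] using h3 _ h.symm⟩
  · refine ⟨(ρ θ)⁻¹, inv_pos.2 (hρ0 θ), ?_⟩
    rw [Complex.exp_mul_I, ← Complex.ofReal_cos, ← Complex.ofReal_sin]
    apply Complex.ext
    · simp [squareToComplex, -Complex.ofReal_cos, -Complex.ofReal_sin]; ring
    · simp [squareToComplex, -Complex.ofReal_cos, -Complex.ofReal_sin]; ring

/-- The boundary identification of the square with a loop around the origin does not extend to a
nowhere vanishing function. -/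
theorem not_exists_nonvanishing_extension {c : (I^(Fin 2)) → ℂ} (hc : Continuous c)
    (h0 : ∀ x, c x ≠ 0) : ¬ ∀ x ∈ Cube.boundary (Fin 2), c x = squareToComplex x := by
  intro hb
  obtain ⟨g, hg, hgc⟩ := exists_continuous_log hc h0
  obtain ⟨γ, hγ, hγ2, hγb⟩ := exists_square_boundary_param
  -- This integer depends continuously on `θ`, hence is constant, yet it drops by `1` from `0` to
  -- `2π` because `γ` closes up.
  have key : ∀ θ : ℝ, ∃ n : ℤ, ((g (γ θ)).im - θ) / (2 * Real.pi) = n := by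
    intro θ
    obtain ⟨hbd, r, hr, hsq⟩ := hγb θ
    have h1 : Complex.exp (g (γ θ)) = Complex.exp (Real.log r + θ * Complex.I) := by
      rw [hgc, hb _ hbd, hsq, Complex.exp_add, ← Complex.ofReal_exp, Real.exp_log hr]
    obtain ⟨n, hn⟩ := Complex.exp_eq_exp_iff_exists_int.1 h1
    refine ⟨n, ?_⟩
    rw [hn]
    simp
  choose n hn using key
  have hcont : Continuous fun θ => ((g (γ θ)).im - θ) / (2 * Real.pi) := by
    have := Complex.continuous_im.comp (hg.comp hγ)
    exact (this.sub continuous_id).div_const _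
  have hnc : Continuous n := by
    rw [Int.isClosedEmbedding_coe_real.isEmbedding.continuous_iff]
    exact hcont.congr hn
  have := PreconnectedSpace.constant inferInstance hnc (x := 0) (y := 2 * Real.pi)
  have h2 := hn 0
  rw [this, ← hn, ← hγ2] at h2
  have := Real.pi_pos
  field_simp at h2
  linarith

/-! ### Fields of lines in `ℂ²` and `π₂` of the sphere. -/

/-- The orthogonal projection of `ℂ²` onto the line through `v`. -/
noncomputable def lineProj (v : ℂ × ℂ) : ℂ × ℂ →L[ℂ] ℂ × ℂ :=
  ((‖v.1‖ ^ 2 + ‖v.2‖ ^ 2 : ℝ) : ℂ)⁻¹ •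
    (starRingEnd ℂ v.1 • ContinuousLinearMap.fst ℂ ℂ ℂ +
      starRingEnd ℂ v.2 • ContinuousLinearMap.snd ℂ ℂ ℂ).smulRight v

theorem normSq_add_normSq_pos {v : ℂ × ℂ} (hv : v ≠ 0) : 0 < ‖v.1‖ ^ 2 + ‖v.2‖ ^ 2 := by
  by_contra! h
  apply hv
  have h1 : ‖v.1‖ ^ 2 = 0 := by nlinarith [sq_nonneg ‖v.1‖, sq_nonneg ‖v.2‖]
  have h2 : ‖v.2‖ ^ 2 = 0 := by nlinarith [sq_nonneg ‖v.1‖, sq_nonneg ‖v.2‖]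
  ext <;> simp_all

theorem lineProj_self {v : ℂ × ℂ} (hv : v ≠ 0) : lineProj v v = v := by
  have := (normSq_add_normSq_pos hv).ne'
  have h : starRingEnd ℂ v.1 * v.1 + starRingEnd ℂ v.2 * v.2
      = ((‖v.1‖ ^ 2 + ‖v.2‖ ^ 2 : ℝ) : ℂ) := by
    rw [Complex.conj_mul', Complex.conj_mul']; push_cast; rfl
  simp only [lineProj, smul_apply, ContinuousLinearMap.smulRight_apply,
    add_apply, ContinuousLinearMap.coe_fst', ContinuousLinearMap.coe_snd',
    smul_eq_mul, h]
  rw [smul_smul, inv_mul_cancel₀ (by exact_mod_cast this), one_smul]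

theorem exists_lineProj_eq_smul (v w : ℂ × ℂ) : ∃ k : ℂ, lineProj v w = k • v :=
  ⟨((‖v.1‖ ^ 2 + ‖v.2‖ ^ 2 : ℝ) : ℂ)⁻¹ * (starRingEnd ℂ v.1 * w.1 + starRingEnd ℂ v.2 * w.2), by
    simp [lineProj, smul_smul]⟩

/-- The result does not depend on `a`: unlike `squareLift` itself, its line is constant on the
boundary of the square. -/
theorem lineProj_mk_zero {a : ℂ} (ha : a ≠ 0) (w : ℂ × ℂ) : lineProj (a, 0) w = (w.1, 0) := by
  have h : starRingEnd ℂ a * a = ((‖a‖ ^ 2 : ℝ) : ℂ) := by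
    rw [Complex.conj_mul']; push_cast; rfl
  have h' : ((‖a‖ ^ 2 : ℝ) : ℂ) ≠ 0 := by simpa using ha
  ext
  · simp only [lineProj, smul_apply, ContinuousLinearMap.smulRight_apply,
      add_apply, ContinuousLinearMap.coe_fst', ContinuousLinearMap.coe_snd',
      smul_eq_mul, Prod.smul_mk, norm_zero, map_zero, zero_mul, add_zero, ne_eq,
      OfNat.ofNat_ne_zero, not_false_eq_true, zero_pow]
    rw [mul_right_comm, h, inv_mul_cancel_left₀ h']
  · simp [lineProj]

theorem continuousOn_lineProj : ContinuousOn lineProj {v | v ≠ 0} := by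
  have h1 : Continuous fun v : ℂ × ℂ => (starRingEnd ℂ v.1 • ContinuousLinearMap.fst ℂ ℂ ℂ +
      starRingEnd ℂ v.2 • ContinuousLinearMap.snd ℂ ℂ ℂ).smulRight v := by
    have h2 : Continuous fun v : ℂ × ℂ => (starRingEnd ℂ v.1 • ContinuousLinearMap.fst ℂ ℂ ℂ +
      starRingEnd ℂ v.2 • ContinuousLinearMap.snd ℂ ℂ ℂ) := by
      have := Complex.continuous_conj
      fun_prop
    exact ((ContinuousLinearMap.smulRightL ℂ (ℂ × ℂ) (ℂ × ℂ)).continuous.comp h2).clm_apply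
      continuous_id
  have h3 : Continuous fun v : ℂ × ℂ => ((‖v.1‖ ^ 2 + ‖v.2‖ ^ 2 : ℝ) : ℂ) := by fun_prop
  refine ContinuousOn.smul (h3.continuousOn.inv₀ fun v hv => ?_) h1.continuousOn
  exact_mod_cast (normSq_add_normSq_pos hv).ne'

/-- The distance of a point of the unit square to the boundary. -/
def squareDepth (x : I^(Fin 2)) : ℝ := min (min (x 0) (1 - x 0)) (min (x 1) (1 - x 1))

theorem continuous_squareDepth : Continuous squareDepth := by
  unfold squareDepth; fun_prop

theorem squareDepth_nonneg (x : I^(Fin 2)) : 0 ≤ squareDepth x := by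
  have h0 := (x 0).2; have h1 := (x 1).2
  simp only [squareDepth, le_min_iff]
  exact ⟨⟨h0.1, by linarith [h0.2]⟩, h1.1, by linarith [h1.2]⟩

theorem squareDepth_eq_zero_iff {x : I^(Fin 2)} :
    squareDepth x = 0 ↔ x ∈ Cube.boundary (Fin 2) := by
  have h0 := (x 0).2; have h1 := (x 1).2
  have : squareDepth x = 0 ↔ squareDepth x ≤ 0 := ⟨le_of_eq, fun h => h.antisymm (squareDepth_nonneg x)⟩
  rw [this]
  simp only [squareDepth, min_le_iff, Cube.boundary, Set.mem_ofPred_eq, Fin.exists_fin_two,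
    Subtype.ext_iff, Set.Icc.coe_zero, Set.Icc.coe_one]
  constructor
  · rintro ((h | h) | (h | h))
    · exact .inl (.inl (by linarith [h0.1]))
    · exact .inl (.inr (by linarith [h0.2]))
    · exact .inr (.inl (by linarith [h1.1]))
    · exact .inr (.inr (by linarith [h1.2]))
  · rintro ((h | h) | (h | h)) <;> simp [h]

/-- A map from the square to `ℂ² ∖ 0` lifting the collapse of the boundary to the Hopf map. -/
noncomputable def squareLift (x : I^(Fin 2)) : ℂ × ℂ := (squareToComplex x, (squareDepth x : ℂ))

theorem squareToComplex_ne_zero {x : I^(Fin 2)} (hx : x ∈ Cube.boundary (Fin 2)) :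
    squareToComplex x ≠ 0 := by
  intro h
  have hre := congrArg Complex.re h
  have him := congrArg Complex.im h
  simp only [squareToComplex, Complex.zero_re, Complex.zero_im] at hre him
  simp only [Cube.boundary, Set.mem_ofPred_eq, Fin.exists_fin_two,
    Subtype.ext_iff, Set.Icc.coe_zero, Set.Icc.coe_one] at hx
  rcases hx with (h | h) | (h | h) <;> linarith

theorem squareLift_ne_zero (x : I^(Fin 2)) : squareLift x ≠ 0 := by
  intro h
  rw [squareLift, Prod.mk_eq_zero, Complex.ofReal_eq_zero, squareDepth_eq_zero_iff] at h
  exact squareToComplex_ne_zero h.2 h.1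

theorem continuous_squareLift : Continuous squareLift :=
  continuous_squareToComplex.prodMk (Complex.continuous_ofReal.comp continuous_squareDepth)

theorem lineProj_squareLift_of_mem_boundary {x : I^(Fin 2)} (hx : x ∈ Cube.boundary (Fin 2))
    (w : ℂ × ℂ) : lineProj (squareLift x) w = (w.1, 0) := by
  rw [squareLift, squareDepth_eq_zero_iff.2 hx, Complex.ofReal_zero]
  exact lineProj_mk_zero (squareToComplex_ne_zero hx) w

/-- If `X` is the quotient of the square by its boundary, then `π₂ X` is not trivial. -/
theorem not_subsingleton_pi_two_of_collapse {X : Type*} [TopologicalSpace X] [T2Space X] {x₀ : X}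
    (φ : C(I^(Fin 2), X)) (hsurj : Function.Surjective φ)
    (hb : ∀ x ∈ Cube.boundary (Fin 2), φ x = x₀)
    (hφ : ∀ x y, φ x = φ y →
      x = y ∨ x ∈ Cube.boundary (Fin 2) ∧ y ∈ Cube.boundary (Fin 2)) :
    ¬ Subsingleton (HomotopyGroup.Pi 2 X x₀) := by
  intro hsub
  have hnull : GenLoop.Homotopic (⟨φ, hb⟩ : GenLoop (Fin 2) X x₀) GenLoop.const :=
    Quotient.exact (hsub.elim _ _)
  obtain ⟨H⟩ : φ.HomotopicRel (ContinuousMap.const _ x₀) (Cube.boundary (Fin 2)) := hnull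
  choose ψ hψ using hsurj
  have hQφ : ∀ x, lineProj (squareLift (ψ (φ x))) = lineProj (squareLift x) := fun x => by
    rcases hφ _ _ (hψ (φ x)) with h | ⟨h, h'⟩
    · rw [h]
    · refine ContinuousLinearMap.ext fun w => ?_
      rw [lineProj_squareLift_of_mem_boundary h, lineProj_squareLift_of_mem_boundary h']
  -- A continuous surjection from a compact space to a Hausdorff space is a quotient map, so
  -- continuity can be checked on the square, whatever the choice of `ψ`.
  have hQ : Continuous fun m => lineProj (squareLift (ψ m)) := by
    have hq : Topology.IsQuotientMap φ := φ.continuous.isClosedMap.isQuotientMap φ.continuous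
      fun m => ⟨ψ m, hψ m⟩
    rw [hq.continuous_iff, show (fun m => lineProj (squareLift (ψ m))) ∘ φ =
      fun x => lineProj (squareLift x) from funext hQφ]
    exact continuousOn_lineProj.comp_continuous continuous_squareLift squareLift_ne_zero
  have hQ0 : ∀ w, lineProj (squareLift (ψ x₀)) w = (w.1, 0) := fun w => by
    have h0 : (0 : I^(Fin 2)) ∈ Cube.boundary (Fin 2) := ⟨0, .inl rfl⟩
    rw [← hb 0 h0, hQφ, lineProj_squareLift_of_mem_boundary h0]
  have hG : Continuous fun p : I × (I^(Fin 2)) => lineProj (squareLift (ψ (H p))) :=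
    hQ.comp H.continuous
  obtain ⟨δ, hδ, hstep⟩ := exists_uniform_time_step hG one_pos
  obtain ⟨v, hvc, hv0, hvP, hvb⟩ : ∃ v : (I^(Fin 2)) → ℂ × ℂ, Continuous v ∧ (∀ x, v x ≠ 0) ∧
      (∀ x, lineProj (squareLift (ψ (H (1, x)))) (v x) = v x) ∧
      ∀ x ∈ Cube.boundary (Fin 2), v x = squareLift x := by
    refine unitInterval.prop_one_of_small_steps
      (P := fun t => ∃ v : (I^(Fin 2)) → ℂ × ℂ, Continuous v ∧ (∀ x, v x ≠ 0) ∧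
      (∀ x, lineProj (squareLift (ψ (H (t, x)))) (v x) = v x) ∧
      ∀ x ∈ Cube.boundary (Fin 2), v x = squareLift x) hδ ?_ ?_
    · refine ⟨squareLift, continuous_squareLift, squareLift_ne_zero, fun x => ?_, fun _ _ => rfl⟩
      have : H (0, x) = φ x := H.apply_zero x
      rw [this, hQφ, lineProj_self (squareLift_ne_zero x)]
    · rintro s t hst ⟨v, hvc, hv0, hvP, hvb⟩
      -- If the projection at time `t` killed `v x`, which the one at time `s` fixes, their
      -- difference would have norm at least `1`.
      have hne : ∀ x, lineProj (squareLift (ψ (H (t, x)))) (v x) ≠ 0 := by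
        intro x h
        have h1 := hstep s t hst x
        rw [dist_eq_norm] at h1
        have h2 := (lineProj (squareLift (ψ (H (s, x)))) -
          lineProj (squareLift (ψ (H (t, x))))).le_opNorm (v x)
        rw [sub_apply, h, hvP, sub_zero] at h2
        have h3 := norm_pos_iff.2 (hv0 x)
        nlinarith
      have hidem : ∀ m w, lineProj (squareLift (ψ m)) (lineProj (squareLift (ψ m)) w) =
          lineProj (squareLift (ψ m)) w := by
        intro m w
        obtain ⟨k, hk⟩ := exists_lineProj_eq_smul (squareLift (ψ m)) w
        rw [hk, map_smul, lineProj_self (squareLift_ne_zero _)]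
      refine ⟨fun x => lineProj (squareLift (ψ (H (t, x)))) (v x), ?_, hne, fun x => hidem _ _, ?_⟩
      · exact (hG.comp (by fun_prop : Continuous fun x : I^(Fin 2) => (t, x))).clm_apply hvc
      · intro x hx
        have : H (t, x) = x₀ := (H.eq_fst t hx).trans (hb x hx)
        beta_reduce
        rw [this, hQ0, hvb x hx, squareLift, squareDepth_eq_zero_iff.2 hx, Complex.ofReal_zero]
  have hv : ∀ x, v x = ((v x).1, 0) := fun x => by
    have : H (1, x) = x₀ := H.apply_one x
    rw [← hQ0, ← this, hvP]
  refine not_exists_nonvanishing_extension (continuous_fst.comp hvc) (fun x h => ?_) fun x hx => ?_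
  · exact hv0 x (by rw [hv]; simpa using h)
  · simp [hvb x hx, squareLift]

/-! ### A metric model of the sphere. -/

/-- The map of the square into `ℝ³` which collapses exactly the boundary, to the origin. -/
noncomputable def collapse (x : I^(Fin 2)) : ℝ × ℝ × ℝ :=
  (x 0 * squareDepth x, x 1 * squareDepth x, squareDepth x)

theorem continuous_collapse : Continuous collapse := by
  have := continuous_squareDepth
  unfold collapse; fun_prop

theorem collapse_of_mem_boundary {x : I^(Fin 2)} (hx : x ∈ Cube.boundary (Fin 2)) :
    collapse x = 0 := by
  simp [collapse, squareDepth_eq_zero_iff.2 hx]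

/-- The last coordinate is the depth; when it is nonzero, dividing by it recovers the point. -/
theorem eq_or_mem_boundary_of_collapse_eq {x y : I^(Fin 2)} (h : collapse x = collapse y) :
    x = y ∨ x ∈ Cube.boundary (Fin 2) ∧ y ∈ Cube.boundary (Fin 2) := by
  simp only [collapse, Prod.mk.injEq] at h
  obtain ⟨h0, h1, hd⟩ := h
  rw [← squareDepth_eq_zero_iff, ← squareDepth_eq_zero_iff, ← hd, and_self]
  by_cases hz : squareDepth x = 0
  · exact .inr hz
  · rw [← hd] at h0 h1
    refine .inl (funext fun i => ?_)
    fin_cases i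
    · exact Subtype.ext (mul_right_cancel₀ hz h0)
    · exact Subtype.ext (mul_right_cancel₀ hz h1)

theorem squareDepth_le_one (x : I^(Fin 2)) : squareDepth x ≤ 1 :=
  (min_le_left _ _).trans ((min_le_left _ _).trans (x 0).2.2)

theorem abs_squareDepth_sub_le {x y : I^(Fin 2)} {η : ℝ} (h0 : |(x 0 : ℝ) - y 0| ≤ η)
    (h1 : |(x 1 : ℝ) - y 1| ≤ η) : |squareDepth x - squareDepth y| ≤ η := by
  have h0' : |(1 - x 0 : ℝ) - (1 - y 0)| ≤ η := by rwa [sub_sub_sub_cancel_left, abs_sub_comm]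
  have h1' : |(1 - x 1 : ℝ) - (1 - y 1)| ≤ η := by rwa [sub_sub_sub_cancel_left, abs_sub_comm]
  exact (abs_min_sub_min_le_max _ _ _ _).trans (max_le
    ((abs_min_sub_min_le_max _ _ _ _).trans (max_le h0 h0'))
    ((abs_min_sub_min_le_max _ _ _ _).trans (max_le h1 h1')))

theorem dist_collapse_le {x y : I^(Fin 2)} {η : ℝ} (h0 : |(x 0 : ℝ) - y 0| ≤ η)
    (h1 : |(x 1 : ℝ) - y 1| ≤ η) : dist (collapse x) (collapse y) ≤ 2 * η := by
  have hd := abs_squareDepth_sub_le h0 h1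
  have hη : 0 ≤ η := (abs_nonneg _).trans h0
  have key : ∀ i, |(x i : ℝ) - y i| ≤ η →
      |(x i : ℝ) * squareDepth x - y i * squareDepth y| ≤ 2 * η := by
    intro i hi
    have e : (x i : ℝ) * squareDepth x - y i * squareDepth y =
      (x i - y i) * squareDepth x + y i * (squareDepth x - squareDepth y) := by ring
    have a1 : |((x i : ℝ) - y i) * squareDepth x| ≤ η * 1 := by
      rw [abs_mul, abs_of_nonneg (squareDepth_nonneg x)]
      exact mul_le_mul hi (squareDepth_le_one x) (squareDepth_nonneg x) hη
    have a2 : |(y i : ℝ) * (squareDepth x - squareDepth y)| ≤ 1 * η := by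
      rw [abs_mul, abs_of_nonneg (y i).2.1]
      exact mul_le_mul (y i).2.2 hd (abs_nonneg _) zero_le_one
    rw [e]
    linarith [abs_add_le (((x i : ℝ) - y i) * squareDepth x)
      ((y i : ℝ) * (squareDepth x - squareDepth y))]
  simp only [Prod.dist_eq, max_le_iff, Real.dist_eq, collapse]
  exact ⟨key 0 h0, key 1 h1, by linarith⟩

/-- The square with its boundary collapsed to a point, scaled by `r`. -/
abbrev CollapsedSquare (r : ℝ) : Type := Set.range fun x => r • collapse x

instance (r : ℝ) : CompactSpace (CollapsedSquare r) :=
  isCompact_iff_compactSpace.1 (isCompact_range (continuous_collapse.const_smul r))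

theorem trivialPi2_collapsedSquare_zero : TrivialPi2 (CollapsedSquare 0) := by
  have : Subsingleton (CollapsedSquare 0) := by
    constructor
    rintro ⟨_, x, rfl⟩ ⟨_, y, rfl⟩
    simp
  intro x
  refine ⟨fun a b => ?_⟩
  induction a, b using Quotient.inductionOn₂ with
  | _ f g => rw [GenLoop.ext f g fun y => Subsingleton.elim _ _]

theorem not_trivialPi2_collapsedSquare {r : ℝ} (hr : r ≠ 0) :
    ¬ TrivialPi2 (CollapsedSquare r) := by
  intro h
  let φ : C(I^(Fin 2), CollapsedSquare r) :=
    ⟨fun x => ⟨r • collapse x, x, rfl⟩, (continuous_collapse.const_smul r).subtype_mk _⟩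
  refine not_subsingleton_pi_two_of_collapse φ (x₀ := φ 0) ?_ ?_ ?_ (h _)
  · rintro ⟨_, x, rfl⟩
    exact ⟨x, rfl⟩
  · intro x hx
    refine Subtype.ext ?_
    change r • collapse x = r • collapse 0
    rw [collapse_of_mem_boundary hx, collapse_of_mem_boundary ⟨0, .inl rfl⟩]
  · intro x y hxy
    exact eq_or_mem_boundary_of_collapse_eq (smul_right_injective _ hr (congrArg Subtype.val hxy))

/-! ### Rational points, their distances and finite nets. -/

/-- The denominator of the coordinates of the `i`-th rational point of the square. -/
def gridDen (i : ℕ) : ℕ := i.unpair.1 + 1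

/-- The truncation by `min` makes every natural number the code of a point of the square. -/
def gridX (i : ℕ) : ℕ := min i.unpair.2.unpair.1 (gridDen i)

def gridY (i : ℕ) : ℕ := min i.unpair.2.unpair.2 (gridDen i)

def gridDepth (i : ℕ) : ℕ :=
  min (min (gridX i) (gridDen i - gridX i)) (min (gridY i) (gridDen i - gridY i))

theorem gridDen_pos (i : ℕ) : 0 < gridDen i := Nat.succ_pos _

/-- The `i`-th rational point of the square. -/
noncomputable def gridPoint (i : ℕ) : I^(Fin 2) :=
  ![⟨gridX i / gridDen i, by positivity,
      div_le_one_of_le₀ (by exact_mod_cast min_le_right _ _) (by positivity)⟩,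
    ⟨gridY i / gridDen i, by positivity,
      div_le_one_of_le₀ (by exact_mod_cast min_le_right _ _) (by positivity)⟩]

theorem gridPoint_zero (i : ℕ) : (gridPoint i 0 : ℝ) = gridX i / gridDen i := rfl

theorem gridPoint_one (i : ℕ) : (gridPoint i 1 : ℝ) = gridY i / gridDen i := rfl

theorem squareDepth_gridPoint (i : ℕ) :
    squareDepth (gridPoint i) = (gridDepth i : ℝ) / gridDen i := by
  have h : (0 : ℝ) < gridDen i := by exact_mod_cast gridDen_pos i
  have hx : gridX i ≤ gridDen i := min_le_right _ _
  have hy : gridY i ≤ gridDen i := min_le_right _ _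
  simp only [squareDepth, gridPoint_zero, gridPoint_one, gridDepth,
    Nat.cast_min, Nat.cast_sub hx, Nat.cast_sub hy]
  rw [← min_div_div_right h.le, ← min_div_div_right h.le, ← min_div_div_right h.le, sub_div,
    sub_div, div_self h.ne']

/-- The distance of two natural numbers. -/
def natDist (m n : ℕ) : ℕ := (m - n) + (n - m)

theorem cast_natDist (m n : ℕ) : (natDist m n : ℝ) = |(m : ℝ) - n| := by
  rcases le_total m n with h | h
  · rw [natDist, Nat.sub_eq_zero_of_le h, zero_add, Nat.cast_sub h, abs_sub_comm,
      abs_of_nonneg (sub_nonneg.2 (by exact_mod_cast h))]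
  · rw [natDist, Nat.sub_eq_zero_of_le h, add_zero, Nat.cast_sub h,
      abs_of_nonneg (sub_nonneg.2 (by exact_mod_cast h))]

def collapseDistDen (i j : ℕ) : ℕ := gridDen i * gridDen i * (gridDen j * gridDen j)

/-- The difference of a coordinate `m / gridDen i ^ 2` and a coordinate `n / gridDen j ^ 2`, over
the denominator `collapseDistDen i j`. -/
def coordDist (i j m n : ℕ) : ℕ :=
  natDist (m * (gridDen j * gridDen j)) (n * (gridDen i * gridDen i))

def collapseDistNum (i j : ℕ) : ℕ :=
  max (coordDist i j (gridX i * gridDepth i) (gridX j * gridDepth j))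
    (max (coordDist i j (gridY i * gridDepth i) (gridY j * gridDepth j))
      (coordDist i j (gridDepth i * gridDen i) (gridDepth j * gridDen j)))

theorem collapseDistDen_pos (i j : ℕ) : 0 < collapseDistDen i j := by
  have := gridDen_pos i; have := gridDen_pos j
  unfold collapseDistDen; positivity

theorem coordDist_div (i j m n : ℕ) : (coordDist i j m n : ℝ) / collapseDistDen i j =
    |(m : ℝ) / (gridDen i * gridDen i) - n / (gridDen j * gridDen j)| := by
  have h1 : (0 : ℝ) < gridDen i := by exact_mod_cast gridDen_pos i
  have h2 : (0 : ℝ) < gridDen j := by exact_mod_cast gridDen_pos j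
  rw [coordDist, cast_natDist, collapseDistDen]
  push_cast
  rw [← abs_of_pos (show (0 : ℝ) < gridDen i * gridDen i * (gridDen j * gridDen j) by positivity),
    ← abs_div]
  congr 1
  field_simp

/-- The product metric is the sup metric, so distances of rational points are exact fractions,
without square roots. -/
theorem dist_collapse_gridPoint (i j : ℕ) :
    dist (collapse (gridPoint i)) (collapse (gridPoint j)) =
      (collapseDistNum i j : ℝ) / collapseDistDen i j := by
  have hpos : (0 : ℝ) < collapseDistDen i j := by exact_mod_cast collapseDistDen_pos i j
  have h1 : (gridDen i : ℝ) ≠ 0 := by exact_mod_cast (gridDen_pos i).ne'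
  have h2 : (gridDen j : ℝ) ≠ 0 := by exact_mod_cast (gridDen_pos j).ne'
  rw [collapseDistNum, Nat.cast_max, Nat.cast_max, ← max_div_div_right hpos.le,
    ← max_div_div_right hpos.le, coordDist_div, coordDist_div, coordDist_div]
  simp only [Prod.dist_eq, Real.dist_eq, collapse, squareDepth_gridPoint]
  simp only [gridPoint_zero, gridPoint_one, Nat.cast_mul]
  rw [div_mul_div_comm, div_mul_div_comm, div_mul_div_comm, div_mul_div_comm,
    mul_div_mul_right _ _ h1, mul_div_mul_right _ _ h2]

theorem dist_collapse_le_one (x y : I^(Fin 2)) : dist (collapse x) (collapse y) ≤ 1 := by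
  have key : ∀ u v : ℝ, u ∈ I → v ∈ I → |u - v| ≤ 1 := fun u v hu hv =>
    abs_sub_le_iff.2 ⟨by linarith [hu.2, hv.1], by linarith [hv.2, hu.1]⟩
  have hd : ∀ x, squareDepth x ∈ I := fun x => ⟨squareDepth_nonneg x, squareDepth_le_one x⟩
  simp only [Prod.dist_eq, max_le_iff, Real.dist_eq, collapse]
  exact ⟨key _ _ (unitInterval.mul_mem (x 0).2 (hd x)) (unitInterval.mul_mem (y 0).2 (hd y)),
    key _ _ (unitInterval.mul_mem (x 1).2 (hd x)) (unitInterval.mul_mem (y 1).2 (hd y)),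
    key _ _ (hd x) (hd y)⟩

theorem Nat.pair_le_pair {a b c d : ℕ} (h1 : a ≤ c) (h2 : b ≤ d) : Nat.pair a b ≤ Nat.pair c d :=
  ((fun b => StrictMono.monotone (f := fun a => Nat.pair a b)
      (fun _ _ h => Nat.pair_lt_pair_left b h)) b h1).trans
    (StrictMono.monotone (f := fun b => Nat.pair c b) (fun _ _ h => Nat.pair_lt_pair_right c h) h2)

/-- A list of numbers of rational points which contains all points with denominator `n + 1`. -/
def gridNet (n : ℕ) : List ℕ := List.range (Nat.pair n (Nat.pair (n + 1) (n + 1)) + 1)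

theorem exists_mem_gridNet (n : ℕ) (x : I^(Fin 2)) : ∃ i ∈ gridNet n,
    dist (collapse x) (collapse (gridPoint i)) ≤ 2 / (n + 1) := by
  have hn : (0 : ℝ) < n + 1 := by positivity
  have hle : ∀ i, ⌊(x i : ℝ) * (n + 1)⌋₊ ≤ n + 1 := fun i => by
    refine Nat.floor_le_of_le ?_
    push_cast
    nlinarith [(x i).2.2]
  have hfl : ∀ i, |(x i : ℝ) - (⌊(x i : ℝ) * (n + 1)⌋₊ : ℝ) / ((n + 1 : ℕ) : ℝ)| ≤ 1 / (n + 1) := by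
    intro i
    have h1 := Nat.floor_le (mul_nonneg (x i).2.1 hn.le)
    have h2 := Nat.lt_floor_add_one ((x i : ℝ) * (n + 1))
    push_cast
    rw [sub_div' hn.ne', abs_div, abs_of_pos hn]
    exact div_le_div_of_nonneg_right (abs_le.2 ⟨by linarith, by linarith⟩) hn.le
  refine ⟨Nat.pair n (Nat.pair ⌊(x 0 : ℝ) * (n + 1)⌋₊ ⌊(x 1 : ℝ) * (n + 1)⌋₊), ?_, ?_⟩
  · rw [gridNet, List.mem_range, Nat.lt_succ_iff]
    exact Nat.pair_le_pair le_rfl (Nat.pair_le_pair (hle 0) (hle 1))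
  · refine (dist_collapse_le (η := 1 / (n + 1)) ?_ ?_).trans_eq (by ring)
    · simpa only [gridPoint_zero, gridX, gridDen, Nat.unpair_pair, min_eq_left (hle 0)]
        using hfl 0
    · simpa only [gridPoint_one, gridY, gridDen, Nat.unpair_pair, min_eq_left (hle 1)]
        using hfl 1

/-! ### The halting time as a radius. -/

/-- The number of steps after which `c` halts on the input `0`, truncated at `K`. -/
def haltDelay (c : Code) (K : ℕ) : ℕ :=
  (List.range K).findIdx fun k => (c.evaln k 0).isSome

open Classical in
/-- `1 / (t + 1)` if `c` halts on the input `0` after exactly `t` steps, `0` if it does not halt. -/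
noncomputable def haltRadius (c : Code) : ℝ :=
  if h : ∃ k, (c.evaln k 0).isSome = true then 1 / (Nat.find h + 1) else 0

theorem exists_evaln_isSome_iff (c : Code) :
    (∃ k, (c.evaln k 0).isSome = true) ↔ (c.eval 0).Dom := by
  simp only [Part.dom_iff_mem, Option.isSome_iff_exists, Code.evaln_complete, Option.mem_def]
  exact exists_comm

theorem haltRadius_ne_zero_iff (c : Code) : haltRadius c ≠ 0 ↔ (c.eval 0).Dom := by
  rw [← exists_evaln_isSome_iff, haltRadius]
  split_ifs with h
  · simp only [h, iff_true]; positivity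
  · simp [h]

theorem haltRadius_mem (c : Code) : 0 ≤ haltRadius c ∧ haltRadius c ≤ 1 := by
  unfold haltRadius
  split_ifs with h
  · exact ⟨by positivity, div_le_one_of_le₀ (by simp) (by positivity)⟩
  · simp

/-- `findIdx` returns the length of the list when no entry qualifies. -/
theorem haltDelay_eq_of_forall {c : Code} {K : ℕ} (h : ∀ k < K, (c.evaln k 0).isSome = false) :
    haltDelay c K = K := by
  rw [haltDelay]
  conv_rhs => rw [← List.length_range (n := K)]
  exact List.findIdx_eq_length.2 fun k hk => h k (List.mem_range.1 hk)

theorem haltDelay_eq_of_isSome {c : Code} {K t : ℕ} (ht : t < K)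
    (h : (c.evaln t 0).isSome = true) (hlt : ∀ k < t, (c.evaln k 0).isSome = false) :
    haltDelay c K = t := by
  rw [haltDelay, List.findIdx_eq (by simpa using ht)]
  simpa [h] using hlt

/-- If `c` halts before stage `K`, the approximation is exact; otherwise it is `1 / (K + 1)` and the
radius lies between `0` and it. -/
theorem abs_haltRadius_sub_le (c : Code) (K : ℕ) :
    |haltRadius c - 1 / (haltDelay c K + 1)| ≤ 1 / (K + 1) := by
  have hK : (0 : ℝ) < 1 / (K + 1) := by positivity
  unfold haltRadius
  split_ifs with h
  · have hmin : ∀ k < Nat.find h, (c.evaln k 0).isSome = false := fun k hk => by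
      simpa using Nat.find_min h hk
    rcases lt_or_ge (Nat.find h) K with hlt | hge
    · rw [haltDelay_eq_of_isSome hlt (Nat.find_spec h) hmin]
      simpa using hK.le
    · rw [haltDelay_eq_of_forall fun k hk => hmin k (hk.trans_le hge)]
      have h1 : (1 : ℝ) / (Nat.find h + 1) ≤ 1 / (K + 1) := by
        gcongr
      have h2 : (0 : ℝ) ≤ 1 / (Nat.find h + 1) := by positivity
      exact abs_le.2 ⟨by linarith, by linarith⟩
  · rw [haltDelay_eq_of_forall fun k _ => by simpa using fun hk => h ⟨k, hk⟩]
    rw [zero_sub, abs_neg, abs_of_pos hK]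

/-- The `i`-th point of the collapsed square. -/
noncomputable def collapsedGridPoint (r : ℝ) (i : ℕ) : CollapsedSquare r :=
  ⟨r • collapse (gridPoint i), _, rfl⟩

/-- The net of precision `p / q` of a collapsed square of radius at most one. -/
def collapsedNet (a : ℕ × ℕ) : List ℕ := gridNet (2 * a.2)

/-- The distance of two points of the collapsed square of radius `haltRadius c`, up to the given
precision, as a fraction. -/
def collapsedDist (a : Code × (ℕ × ℕ) × ℕ × ℕ) : ℕ × ℕ :=
  (collapseDistNum a.2.1.1 a.2.1.2,
    collapseDistDen a.2.1.1 a.2.1.2 * (haltDelay a.1 a.2.2.2 + 1))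

/-! ### Computability of the net and of the distance. -/

section Primrec

theorem primrec_gridDen : Primrec gridDen :=
  Primrec.succ.comp (Primrec.fst.comp Primrec.unpair)

theorem primrec_gridX : Primrec gridX :=
  Primrec.nat_min.comp (Primrec.fst.comp (Primrec.unpair.comp (Primrec.snd.comp Primrec.unpair)))
    primrec_gridDen

theorem primrec_gridY : Primrec gridY :=
  Primrec.nat_min.comp (Primrec.snd.comp (Primrec.unpair.comp (Primrec.snd.comp Primrec.unpair)))
    primrec_gridDen

theorem primrec_gridDepth : Primrec gridDepth :=
  Primrec.nat_min.comp
    (Primrec.nat_min.comp primrec_gridX (Primrec.nat_sub.comp primrec_gridDen primrec_gridX))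
    (Primrec.nat_min.comp primrec_gridY (Primrec.nat_sub.comp primrec_gridDen primrec_gridY))

theorem primrec_natDist : Primrec₂ natDist :=
  Primrec.nat_add.comp (Primrec.nat_sub.comp Primrec.fst Primrec.snd)
    (Primrec.nat_sub.comp Primrec.snd Primrec.fst)

theorem primrec_gridDen_sq : Primrec fun i => gridDen i * gridDen i :=
  Primrec.nat_mul.comp primrec_gridDen primrec_gridDen

theorem primrec_collapseDistDen : Primrec₂ collapseDistDen :=
  Primrec.nat_mul.comp (primrec_gridDen_sq.comp Primrec.fst) (primrec_gridDen_sq.comp Primrec.snd)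

theorem primrec_coordDist {f : ℕ → ℕ} (hf : Primrec f) :
    Primrec₂ fun i j => coordDist i j (f i) (f j) :=
  primrec_natDist.comp
    (Primrec.nat_mul.comp (hf.comp Primrec.fst) (primrec_gridDen_sq.comp Primrec.snd))
    (Primrec.nat_mul.comp (hf.comp Primrec.snd) (primrec_gridDen_sq.comp Primrec.fst))

theorem primrec_collapseDistNum : Primrec₂ collapseDistNum := by
  have h1 := primrec_coordDist (f := fun i => gridX i * gridDepth i)
    (Primrec.nat_mul.comp primrec_gridX primrec_gridDepth)
  have h2 := primrec_coordDist (f := fun i => gridY i * gridDepth i)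
    (Primrec.nat_mul.comp primrec_gridY primrec_gridDepth)
  have h3 := primrec_coordDist (f := fun i => gridDepth i * gridDen i)
    (Primrec.nat_mul.comp primrec_gridDepth primrec_gridDen)
  exact Primrec.nat_max.comp₂ h1 (Primrec.nat_max.comp₂ h2 h3)

theorem primrec_haltDelay : Primrec₂ haltDelay :=
  Primrec.list_findIdx (Primrec.list_range.comp Primrec.snd)
    (Primrec.option_isSome.comp (Code.primrec_evaln.comp
      ((Primrec.snd.pair (Primrec.fst.comp Primrec.fst)).pair (Primrec.const 0))))

theorem primrec_collapsedDist : Primrec collapsedDist := by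
  have hi : Primrec fun a : Code × (ℕ × ℕ) × ℕ × ℕ => a.2.1.1 :=
    Primrec.fst.comp (Primrec.fst.comp Primrec.snd)
  have hj : Primrec fun a : Code × (ℕ × ℕ) × ℕ × ℕ => a.2.1.2 :=
    Primrec.snd.comp (Primrec.fst.comp Primrec.snd)
  have hq : Primrec fun a : Code × (ℕ × ℕ) × ℕ × ℕ => a.2.2.2 :=
    Primrec.snd.comp (Primrec.snd.comp Primrec.snd)
  exact (primrec_collapseDistNum.comp hi hj).pair
    (Primrec.nat_mul.comp (primrec_collapseDistDen.comp hi hj)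
      (Primrec.succ.comp (primrec_haltDelay.comp Primrec.fst hq)))

theorem primrec_collapsedNet : Primrec collapsedNet := by
  have hn : Primrec fun a : ℕ × ℕ => 2 * a.2 :=
    Primrec.nat_mul.comp (Primrec.const 2) Primrec.snd
  have hn1 := Primrec.succ.comp hn
  exact Primrec.list_range.comp (Primrec.succ.comp
    (Primrec₂.natPair.comp hn (Primrec₂.natPair.comp hn1 hn1)))

end Primrec

/-! ### The presentation and the reduction. -/

theorem Computable.exists_code {α β : Type*} [Primcodable α] [Primcodable β] {f : α → β}
    (hf : Computable f) :
    ∃ d : Code, ∀ a, d.eval (Encodable.encode a) = Part.some (Encodable.encode (f a)) := by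
  obtain ⟨d, hd⟩ := Code.exists_code.1 hf
  exact ⟨d, fun a => by simp [hd]⟩

/-- One net program serves all `c`, since the radius is at most `1`; only the distance program
depends on `c`, by currying. -/
theorem presents_collapsedSquare {net dst c : Code}
    (hnet : ∀ a, net.eval (Encodable.encode a) = Part.some (Encodable.encode (collapsedNet a)))
    (hdst : ∀ a, dst.eval (Encodable.encode a) = Part.some (Encodable.encode (collapsedDist a))) :
    Presents (net, dst.curry (Encodable.encode c)) (CollapsedSquare (haltRadius c)) := by
  obtain ⟨hr0, hr1⟩ := haltRadius_mem c
  have hdist : ∀ x y : I^(Fin 2), dist (haltRadius c • collapse x) (haltRadius c • collapse y) =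
      haltRadius c * dist (collapse x) (collapse y) := fun x y => by
    rw [dist_smul₀, Real.norm_of_nonneg hr0]
  refine ⟨collapsedGridPoint (haltRadius c), fun p q hp hq => ?_, fun i j p q hp hq => ?_⟩
  · refine ⟨collapsedNet (p, q), by rw [hnet]; exact Part.mem_some _, ?_⟩
    rintro ⟨_, x, rfl⟩
    obtain ⟨i, hi, hxi⟩ := exists_mem_gridNet (2 * q) x
    refine ⟨i, hi, ?_⟩
    change dist (haltRadius c • collapse x) (haltRadius c • collapse (gridPoint i)) < _
    rw [hdist]
    have hp' : (1 : ℝ) ≤ p := by exact_mod_cast hp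
    have hq' : (0 : ℝ) < q := by exact_mod_cast hq
    -- The grid of index `n` has error `2 / (n + 1)`; `n = 2 * q` brings it below `1 / q`.
    calc haltRadius c * dist (collapse x) (collapse (gridPoint i))
        ≤ 1 * (2 / ((2 * q : ℕ) + 1)) := by gcongr
      _ < 1 / q := by
        rw [one_mul, div_lt_div_iff₀ (by positivity) hq']
        push_cast
        linarith
      _ ≤ p / q := by gcongr
  · refine ⟨collapseDistNum i j, collapseDistDen i j * (haltDelay c q + 1),
      Nat.mul_pos (collapseDistDen_pos i j) (Nat.succ_pos _), ?_, ?_⟩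
    · have := hdst (c, (i, j), (p, q))
      rw [Code.eval_curry]
      rw [Encodable.encode_prod_val] at this
      rw [this]
      exact Part.mem_some _
    · change |dist (haltRadius c • collapse (gridPoint i))
        (haltRadius c • collapse (gridPoint j)) - _| < _
      have hD := dist_collapse_le_one (gridPoint i) (gridPoint j)
      have hp' : (1 : ℝ) ≤ p := by exact_mod_cast hp
      have hq' : (0 : ℝ) < q := by exact_mod_cast hq
      -- The unscaled distance is exact, so the only error is that of the radius.
      have e : haltRadius c * dist (collapse (gridPoint i)) (collapse (gridPoint j)) -
          (collapseDistNum i j : ℝ) / (collapseDistDen i j * (haltDelay c q + 1) : ℕ) =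
          (haltRadius c - 1 / (haltDelay c q + 1)) *
            dist (collapse (gridPoint i)) (collapse (gridPoint j)) := by
        rw [dist_collapse_gridPoint, sub_mul, div_mul_div_comm, one_mul]
        push_cast
        rw [mul_comm (collapseDistDen i j : ℝ) (_ + 1)]
      rw [hdist, e, abs_mul, abs_of_nonneg (dist_nonneg (x := collapse _))]
      calc |haltRadius c - 1 / (haltDelay c q + 1)| *
            dist (collapse (gridPoint i)) (collapse (gridPoint j))
          ≤ 1 / (q + 1) * 1 :=
            mul_le_mul (abs_haltRadius_sub_le c q) hD dist_nonneg (by positivity)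
        _ < 1 / q := by
          rw [mul_one]
          exact one_div_lt_one_div_of_lt hq' (by linarith)
        _ ≤ p / q := by gcongr

theorem theorem1 :
    ¬ ∃ Q : Nat.Partrec.Code × Nat.Partrec.Code →. Bool, Partrec Q ∧
      ∀ (P : Nat.Partrec.Code × Nat.Partrec.Code)
        (X : Type) [MetricSpace X] [CompactSpace X], Presents P X →
          ∃ b ∈ Q P, (b = true ↔ TrivialPi2 X) := by
  rintro ⟨Q, hQ, hdec⟩
  obtain ⟨net, hnet⟩ := primrec_collapsedNet.to_comp.exists_code
  obtain ⟨dst, hdst⟩ := primrec_collapsedDist.to_comp.exists_code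
  have hcomp : Computable fun c : Code => (net, dst.curry (Encodable.encode c)) :=
    ((Primrec.const net).pair
      (Code.primrec₂_curry.comp (Primrec.const dst) Primrec.encode)).to_comp
  have hb : ∀ c : Code, ∃ b ∈ Q (net, dst.curry (Encodable.encode c)),
      (b = false ↔ (c.eval 0).Dom) := fun c => by
    obtain ⟨b, hbQ, hbiff⟩ := hdec _ _ (presents_collapsedSquare (c := c) hnet hdst)
    refine ⟨b, hbQ, ?_⟩
    rw [← Bool.not_eq_true, hbiff, ← haltRadius_ne_zero_iff]
    refine ⟨fun h h0 => h (h0 ▸ trivialPi2_collapsedSquare_zero), not_trivialPi2_collapsedSquare⟩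
  choose b hbQ hbiff using hb
  have hbc : Computable b := (hQ.comp hcomp).of_eq_tot hbQ
  refine ComputablePred.halting_problem 0 (ComputablePred.computable_iff.2
    ⟨fun c => !b c, Primrec.not.to_comp.comp hbc, funext fun c => propext ?_⟩)
  rw [← hbiff]
  simp
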